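/- Let $\mathbb K$ be an algebraically closed field of characteristic zero, and fix $i\in\mathbb K$ with $i^2=-1$. Let $n\ge 2$, let $R$ be a commutative local $\mathbb K$-algebra with unit, of dimension $n+2$ over $\mathbb K$, with maximal ideal $\mathfrak m$, and let $F$ be a symmetric bilinear form of rank $n+1$ on $R$ with $F(1,1)=0$. Assume that $W$ is a hyperplane in $\mathfrak m$ such that $$F(ab_1,b_2)+F(b_1,ab_2)=0\qquad\text{for all } a\in W,\ b_1,b_2\in R .$$ Then $R$ has a basis $e_0=1,e_1,\dots,e_n,e_{n+1}$ with $W=\langle e_1,\dots,e_n\rangle$, $\mathfrak m=\langle e_1,\dots,e_{n+1}\rangle$ and $e_{n+1}=e_1^2$, in which $$F(e_0,e_{n+1})=F(e_{n+1},e_0)=1,\qquad F(e_j,e_j)=-1\ \ (1\le j\le n-1),$$ and $F$ vanishes on all other pairs of basis vectors, and such that one of the following holds. 1. $n\ge 3$, and for some matrix $\Lambda=(\lambda_{jk})$ as described below there is an isomorphism $$R\cong\mathbb K[e_1,\dots,e_n]/\bigl(e_je_k-\lambda_{jk}e_n,\ e_j^2-e_k^2-(\lambda_{jj}-\lambda_{kk})e_n,\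 e_se_n\ ;\ 1\le j<k\le n-1,\ 1\le s\le n\bigr)$$ of $\mathbb K$-algebras under which the basis vectors $e_1,\dots,e_n$ correspond to the classes of the variables of the same name. Here $\Lambda$ is a symmetric block diagonal $(n-1)\times(n-1)$-matrix over $\mathbb K$, each of whose diagonal blocks has, for some size $s\ge 1$ and some $\lambda\in\mathbb K$, the form $$\lambda E+\tfrac12 A+\tfrac i2 B,$$ where $E$ is the identity $s\times s$-matrix, $A_{pq}=1$ if $|p-q|=1$ and $A_{pq}=0$ otherwise, and $B_{pq}=1$ if $p+q=s$, $B_{pq}=-1$ if $p+q=s+2$, and $B_{pq}=0$ otherwise ($1\le p,q\le s$). (This is the canonical form of a symmetric matrix under orthogonal transformations.) 2. $n=2$, and either $R\cong\mathbb K[e_1,e_2]/(e_1^3,e_1e_2,e_2^2)$, where the basis vectors $e_1,e_2$ correspond to the classes of the variables, or $R\cong\mathbb K[e_1]/(e_1^4)$, where the basis vector $e_1$ corresponds to the class of the variable and $e_2=e_1^3$, $e_3=e_1^2$. -/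

import Mathlib

namespace CorankOne

/-- The invariance condition `F (a b₁, b₂) + F (b₁, a b₂) = 0` for all `a ∈ W` and `b₁, b₂ ∈ R`. -/
def IsInvariant {K R : Type*} [Field K] [CommRing R] [Algebra K R]
    (W : Submodule K R) (F : LinearMap.BilinForm K R) : Prop :=
  ∀ a ∈ W, ∀ b₁ b₂ : R, F (a * b₁) b₂ + F b₁ (a * b₂) = 0

/-- The normal form of the matrix of `F`, with rows and columns numbered `0, …, n + 1`:
the entries at `(0, n + 1)` and `(n + 1, 0)` are `1`, the diagonal entries number `1, …, n - 1`
are `-1`, and all other entries are `0`. -/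
def normalMatrix (K : Type*) [Field K] (n : ℕ) : Matrix (Fin (n + 2)) (Fin (n + 2)) K :=
  Matrix.of fun i j =>
    if (i = 0 ∧ j = Fin.last (n + 1)) ∨ (i = Fin.last (n + 1) ∧ j = 0) then 1
    else if i = j ∧ 0 < (i : ℕ) ∧ (i : ℕ) < n then -1
    else 0

/-- The symmetric Jordan block of size `s` with parameter `c`, where `im` is a square root of `-1`.
Rows and columns are numbered from `0`: the second summand has ones next to the main diagonal; the
third has `1` on the antidiagonal just above the main one and `-1` on the one just below it. -/
def symmBlock {K : Type*} [Field K] (im : K) (s : ℕ) (c : K) : Matrix (Fin s) (Fin s) K :=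
  c • (1 : Matrix (Fin s) (Fin s) K)
    + (1 / 2 : K) • (Matrix.of fun a b : Fin s =>
        if (a : ℕ) + 1 = b ∨ (b : ℕ) + 1 = a then 1 else 0)
    + (im / 2) • (Matrix.of fun a b : Fin s =>
        if (a : ℕ) + b + 2 = s then 1 else if (a : ℕ) + b = s then -1 else 0)

/-- `L` is block diagonal, with consecutive diagonal blocks `symmBlock im (s k) (c k)` of
positive sizes `s 0, …, s (r - 1)`. -/
def IsCanonical {K : Type*} [Field K] (im : K) {m : ℕ} (L : Matrix (Fin m) (Fin m) K) : Prop :=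
  ∃ (r : ℕ) (s : Fin r → ℕ) (c : Fin r → K) (h : ∑ k, s k = m),
    (∀ k, 0 < s k) ∧
    L = Matrix.reindex (finSigmaFinEquiv.trans (finCongr h)) (finSigmaFinEquiv.trans (finCongr h))
      (Matrix.blockDiagonal' fun k => symmBlock im (s k) (c k))

/-- The ideal of `K[e₁, …, eₙ]` generated by `eᵢ eⱼ - L i j eₙ` and
`eᵢ² - eⱼ² - (L i i - L j j) eₙ` for `1 ≤ i < j ≤ n - 1`, and `eₛ eₙ` for `1 ≤ s ≤ n`.
Indices start at `0` in the code, so `eₙ` is the variable number `n - 1`. -/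
noncomputable def relIdeal {K : Type*} [Field K] {n : ℕ} (hn : 0 < n)
    (L : Matrix (Fin (n - 1)) (Fin (n - 1)) K) : Ideal (MvPolynomial (Fin n) K) :=
  let v : Fin (n - 1) → MvPolynomial (Fin n) K :=
    fun i => MvPolynomial.X (Fin.castLE (Nat.sub_le n 1) i)
  let z : MvPolynomial (Fin n) K := MvPolynomial.X ⟨n - 1, Nat.sub_lt hn Nat.one_pos⟩
  Ideal.span
    ({p | ∃ i j : Fin (n - 1), i < j ∧ p = v i * v j - MvPolynomial.C (L i j) * z}
      ∪ {p | ∃ i j : Fin (n - 1), i < j ∧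
          p = v i ^ 2 - v j ^ 2 - MvPolynomial.C (L i i - L j j) * z}
      ∪ {p | ∃ s : Fin n, p = MvPolynomial.X s * z})

end CorankOne

/-! Multiplication by `a ∈ W` is skew for `F`, so `F a x = -F 1 (a * x)`. With symmetry this makes
`F 1` vanish on `W` and on triple products from `W`. Since `F` has corank one and `n ≥ 2`, the form
`F 1 (x * y)` cannot vanish on `W`; this gives `a ∈ W` with `F 1 (a * a) = 1`, and `R` is spanned by
`1`, `W` and `a * a`.

The decisive point is `mul_sub_mem_ker`. For `b, c ∈ W` the element `b * c - F 1 (b * c) • (a * a)`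
is a combination of products of two elements of `W`, hence acts self-adjointly; it also lies in `W`,
hence acts skewly. So it lies in the kernel of `F`, which is a line `K z` inside `W` annihilated by
the maximal ideal (`mul_eq_zero_of_mem_ker`, `ker_le`). Thus multiplication on `W` reads `x * y = F
1 (x * y) • u + g (x * y) • z`: it is encoded by two symmetric forms, the first nondegenerate on a
complement of `K z` in `W`.

Bringing this pair of forms to normal form is the classification of symmetric matrices under
orthogonal transformations (`exists_orthonormal_isCanonical`), and it yields `Λ`. The relations then
hold in `R`, and they leave at most `n + 2` spanning classes in the polynomial quotient, so the
surjection onto `R` is bijective by dimension. For `n ≥ 3` the relations force `e₁ ^ 3 = 0`; for `n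
= 2` the cube only has to lie in `K z`, whence two algebras. -/

namespace CorankOne

/-! ### Splitting one symmetric Jordan block off a self-adjoint operator. -/

section CanonicalForm

variable {K V : Type*} [Field K] [AddCommGroup V] [Module K V]

/-- Polarization: a symmetric bilinear form vanishing on the diagonal vanishes. -/
theorem apply_eq_zero_of_diag_eq_zero [CharZero K] {B : V → V → K} (hs : ∀ x y, B x y = B y x)
    (hadd : ∀ x y z, B (x + y) z = B x z + B y z) {S : Submodule K V}
    (h : ∀ x ∈ S, B x x = 0) {x y : V} (hx : x ∈ S) (hy : y ∈ S) : B x y = 0 := by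
  have h1 := h _ (S.add_mem hx hy)
  rw [hadd, hs x, hs y, hadd, hadd, h x hx, h y hy, hs y x] at h1
  have h2 : (2 : K) * B x y = 0 := by linear_combination h1
  simpa using h2

theorem pow_selfAdjoint {b : LinearMap.BilinForm K V} {N : Module.End K V}
    (hN : ∀ x y, b (N x) y = b x (N y)) (k : ℕ) (x y : V) :
    b ((N ^ k) x) y = b x ((N ^ k) y) := by
  induction k generalizing x y with
  | zero => simp
  | succ k ih => rw [pow_succ, Module.End.mul_apply, ih, hN, ← Module.End.mul_apply, ← pow_succ',
      ← pow_succ]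

/-- A self-adjoint operator with nontrivial kernel has a nilpotent vector `v` of some order `t + 1`
with `b v (N ^ t v) ≠ 0`. -/
theorem exists_nonisotropic_nilpotent [CharZero K] [FiniteDimensional K V] {b : LinearMap.BilinForm K V}
    (hs : ∀ x y, b x y = b y x) (hb : ∀ x, (∀ y, b x y = 0) → x = 0) {N : Module.End K V}
    (hN : ∀ x y, b (N x) y = b x (N y)) {x₀ : V} (hx₀ : x₀ ≠ 0) (hNx₀ : N x₀ = 0) :
    ∃ (t : ℕ) (v : V), (N ^ (t + 1)) v = 0 ∧ b v ((N ^ t) v) ≠ 0 := by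
  classical
  -- Fitting decomposition; the exponent `d₀ + 1` is positive, so `x₀` lies in `ker (N ^ d)` even if
  -- `d₀ = 0`.
  obtain ⟨d₀, hd₀⟩ := Filter.eventually_atTop.mp N.eventually_isCompl_ker_pow_range_pow
  set d := d₀ + 1
  have hc : IsCompl (LinearMap.ker (N ^ d)) (LinearMap.range (N ^ d)) := hd₀ d (by omega)
  have hex : ∃ s, ∀ x ∈ LinearMap.ker (N ^ d), (N ^ s) x = 0 := ⟨d, fun x hx => hx⟩
  have hs0 : Nat.find hex ≠ 0 := by
    intro h0
    have h1 := Nat.find_spec hex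
    rw [h0] at h1
    refine hx₀ (h1 x₀ ?_)
    simp [d, pow_succ, hNx₀]
  obtain ⟨t, ht⟩ := Nat.exists_eq_succ_of_ne_zero hs0
  have hspec := Nat.find_spec hex
  have hmin := Nat.find_min hex (m := t) (by omega)
  rw [ht] at hspec
  push Not at hmin
  obtain ⟨x, hx, hxt⟩ := hmin
  by_contra! hcon
  -- Here `t + 1` is the least exponent killing `ker (N ^ d)`. If this diagonal vanished,
  -- polarization would make `N ^ t x` orthogonal to the kernel; it is orthogonal to the range
  -- anyway, hence zero.
  have hdiag : ∀ v ∈ LinearMap.ker (N ^ d), b v ((N ^ t) v) = 0 := fun v hv =>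
    hcon t v (hspec v hv)
  refine hxt (hb _ fun z => ?_)
  obtain ⟨z₀, hz₀, z₁, ⟨z₂, rfl⟩, rfl⟩ := Submodule.mem_sup.mp
    (hc.sup_eq_top ▸ Submodule.mem_top : z ∈ _)
  have hx' : (N ^ d) x = 0 := hx
  have h2 : b ((N ^ t) x) ((N ^ d) z₂) = 0 := by
    rw [← pow_selfAdjoint hN, ← Module.End.mul_apply, ← pow_add, add_comm, pow_add,
      Module.End.mul_apply, hx']
    simp
  have h3 := apply_eq_zero_of_diag_eq_zero (B := fun x y => b x ((N ^ t) y))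
    (fun x y => by rw [← pow_selfAdjoint hN, hs]) (by simp) hdiag hx hz₀
  rw [map_add, h2, pow_selfAdjoint hN, h3, add_zero]

/-- One can achieve that `v` is orthogonal to `N ^ k v` for all `k ≠ t`. -/
theorem exists_cyclic_orthogonal [CharZero K] {b : LinearMap.BilinForm K V}
    {N : Module.End K V} (hN : ∀ x y, b (N x) y = b x (N y)) {t : ℕ} {v : V} (hv : (N ^ (t + 1)) v = 0)
    (hvt : b v ((N ^ t) v) ≠ 0) (j : ℕ) :
    ∃ v : V, (N ^ (t + 1)) v = 0 ∧ b v ((N ^ t) v) ≠ 0 ∧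
      ∀ k, t ≤ k + j → k < t → b v ((N ^ k) v) = 0 := by
  induction j with
  | zero => exact ⟨v, hv, hvt, fun k h1 h2 => by omega⟩
  | succ j ih =>
    obtain ⟨v, hv, hvt, h0⟩ := ih
    by_cases hj : t < j + 1
    · exact ⟨v, hv, hvt, fun k h1 h2 => h0 k (by omega) h2⟩
    have hz : ∀ m, t < m → (N ^ m) v = 0 := fun m hm => by
      obtain ⟨l, rfl⟩ := Nat.exists_eq_add_of_lt hm
      rw [show t + l + 1 = l + (t + 1) by ring, pow_add, Module.End.mul_apply, hv, map_zero]
    -- Adding `α • N ^ (j + 1) v` changes the pairing at `k = t - (j + 1)` by `2 * α * b v (N ^ t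
    -- v)` and leaves those at larger `k` alone, because `N ^ (t + 1) v = 0`.
    set α : K := -b v ((N ^ (t - (j + 1))) v) / (2 * b v ((N ^ t) v)) with hα
    have key : ∀ k, b (v + α • (N ^ (j + 1)) v) ((N ^ k) (v + α • (N ^ (j + 1)) v))
        = b v ((N ^ k) v) + 2 * α * b v ((N ^ (k + (j + 1))) v)
          + α ^ 2 * b v ((N ^ (k + (j + 1) + (j + 1))) v) := fun k => by
      simp only [map_add, map_smul, LinearMap.add_apply, LinearMap.smul_apply, smul_eq_mul,
        pow_selfAdjoint hN, ← Module.End.mul_apply, ← pow_add]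
      rw [add_comm (j + 1) k, add_comm (j + 1) (k + (j + 1))]
      ring
    refine ⟨v + α • (N ^ (j + 1)) v, ?_, ?_, fun k h1 h2 => ?_⟩
    · rw [map_add, map_smul, ← Module.End.mul_apply, ← pow_add, hv, hz _ (by omega)]
      simp
    · rw [key, hz (t + (j + 1)) (by omega), hz (t + (j + 1) + (j + 1)) (by omega)]
      simpa using hvt
    · rw [key, hz (k + (j + 1) + (j + 1)) (by omega)]
      by_cases hk : k = t - (j + 1)
      · rw [show k + (j + 1) = t by omega, hk, hα]
        field_simp
        simp
      · rw [h0 k (by omega) h2, hz _ (by omega)]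
        simp

/-- A self-adjoint operator has an invariant nondegenerate subspace on which, in some orthonormal
basis, its matrix is a symmetric Jordan block. -/
theorem exists_symmBlock [IsAlgClosed K] [CharZero K] [FiniteDimensional K V] [Nontrivial V] {im : K} (him : im ^ 2 = -1)
    {b : LinearMap.BilinForm K V}
    (hs : ∀ x y, b x y = b y x) (hb : ∀ x, (∀ y, b x y = 0) → x = 0) {T : Module.End K V}
    (hT : ∀ x y, b (T x) y = b x (T y)) :
    ∃ (s : ℕ) (c : K) (u : Fin s → V), 0 < s ∧
      (∀ p q, b (u p) (u q) = if p = q then 1 else 0) ∧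
      (∀ p q, b (u p) (T (u q)) = symmBlock im s c p q) ∧
      ∀ y, (∀ q, b (u q) y = 0) → ∀ q, b (u q) (T y) = 0 := by
  obtain ⟨c, hc⟩ := Module.End.exists_eigenvalue T
  obtain ⟨x₀, hx₀⟩ := hc.exists_hasEigenvector
  set N : Module.End K V := T - c • 1 with hNdef
  have hTN : ∀ x, T x = c • x + N x := fun x => by simp [hNdef]
  have hN : ∀ x y, b (N x) y = b x (N y) := fun x y => by simp [hNdef, hT]
  obtain ⟨t, v₀, hv₀, hvt₀⟩ := exists_nonisotropic_nilpotent hs hb hN hx₀.2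
    (by simp [hNdef, hx₀.apply_eq_smul])
  obtain ⟨v₁, hv₁, hvt₁, h₁⟩ := exists_cyclic_orthogonal hN hv₀ hvt₀ t
  -- The scaling makes `b (x k) (x l)` equal to `im / 2` on the antidiagonal `k + l = t`, so that
  -- the vectors `x p - im • x (t - p)` are orthonormal.
  obtain ⟨r, hr⟩ := IsAlgClosed.exists_pow_nat_eq (im / 2 / b v₁ ((N ^ t) v₁)) (n := 2) (by norm_num)
  have him0 : im ≠ 0 := by rintro rfl; norm_num at him
  set x : ℕ → V := fun k => (N ^ k) (r • v₁) with hx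
  have hxx : ∀ k l, b (x k) (x l) = if k + l = t then im / 2 else 0 := fun k l => by
    have h2 : b (x k) (x l) = r ^ 2 * b v₁ ((N ^ (k + l)) v₁) := by
      simp only [hx, map_smul, LinearMap.smul_apply, smul_eq_mul,
        pow_selfAdjoint hN, ← Module.End.mul_apply, ← pow_add]
      ring
    rw [h2, hr]
    split_ifs with h
    · rw [h]; field_simp
    · rcases lt_or_gt_of_ne h with h | h
      · rw [h₁ _ (by omega) h, mul_zero]
      · obtain ⟨l, hl⟩ := Nat.exists_eq_add_of_lt h
        rw [hl, show t + l + 1 = l + (t + 1) by ring, pow_add, Module.End.mul_apply, hv₁]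
        simp
  have hNx : ∀ k, N (x k) = x (k + 1) := fun k => by
    simp only [hx, pow_succ', Module.End.mul_apply]
  set u : Fin (t + 1) → V := fun p => x p - im • x (t - p) with hu
  refine ⟨t + 1, c, u, by omega, ?_, ?_, ?_⟩
  · intro p q
    have h1 : ((t - p + (t - q) = t) ↔ ((p : ℕ) + q = t)) := by omega
    have h2 : (((p : ℕ) + (t - q) = t) ↔ p = q) := by omega
    have h3 : ((t - (p : ℕ) + q = t) ↔ p = q) := by omega
    simp only [hu, map_sub, map_smul, LinearMap.sub_apply, LinearMap.smul_apply, smul_eq_mul, hxx,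
      h1, h2, h3]
    simp only [← mul_boole _ (im / 2)]
    linear_combination (im / 2 * (if (p : ℕ) + q = t then 1 else 0) - if p = q then 1 else 0) * him
  · intro p q
    have hp := p.2
    have hq := q.2
    have h1 : ((t - p + (t - q) = t) ↔ ((p : ℕ) + q = t)) := by omega
    have h2 : (((p : ℕ) + (t - q) = t) ↔ p = q) := by omega
    have h3 : ((t - (p : ℕ) + q = t) ↔ p = q) := by omega
    have h4 : ((t - p + (t - q + 1) = t) ↔ ((p : ℕ) + q = t + 1)) := by omega
    have h5 : (((p : ℕ) + (t - q + 1) = t) ↔ (p : ℕ) + 1 = q) := by omega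
    have h6 : ((t - (p : ℕ) + (q + 1) = t) ↔ (q : ℕ) + 1 = p) := by omega
    have h7 : (((p : ℕ) + (q + 1) = t) ↔ (p : ℕ) + q + 2 = t + 1) := by omega
    simp only [hTN, hu, map_sub, map_smul, LinearMap.sub_apply, LinearMap.smul_apply, smul_eq_mul,
      map_add, hNx, hxx, h1, h2, h3, h4, h5, h6, h7, symmBlock, Matrix.add_apply,
      Matrix.smul_apply, Matrix.one_apply, Matrix.of_apply]
    have h8 : (if (p : ℕ) + 1 = q ∨ (q : ℕ) + 1 = p then (1 : K) else 0)
        = (if (p : ℕ) + 1 = q then 1 else 0) + if (q : ℕ) + 1 = p then 1 else 0 := by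
      split_ifs <;> first | omega | simp
    have h9 : (if (p : ℕ) + q + 2 = t + 1 then (1 : K) else if (p : ℕ) + q = t + 1 then -1 else 0)
        = (if (p : ℕ) + q + 2 = t + 1 then 1 else 0) - if (p : ℕ) + q = t + 1 then 1 else 0 := by
      split_ifs <;> first | omega | simp
    rw [h8, h9]
    simp only [← mul_boole _ (im / 2)]
    linear_combination (c * (im / 2 * (if (p : ℕ) + q = t then 1 else 0) - if p = q then 1 else 0)
      + im / 2 * (if (p : ℕ) + q = t + 1 then 1 else 0)
      - ((if (p : ℕ) + 1 = q then 1 else 0) + if (q : ℕ) + 1 = p then 1 else 0) / 2) * him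
  · intro y hy q
    -- Since `u k + im • u (t - k) = 2 • x k`, orthogonality to the `u q` is orthogonality to the
    -- whole cyclic space, which is stable under `N`.
    have h1 : ∀ k, k ≤ t → b (x k) y = 0 := fun k hk => by
      have e1 := hy ⟨k, by omega⟩
      have e2 := hy ⟨t - k, by omega⟩
      simp only [hu, map_sub, map_smul, LinearMap.sub_apply, LinearMap.smul_apply, smul_eq_mul]
        at e1 e2
      rw [show t - (t - k) = k by omega] at e2
      have : (2 : K) * b (x k) y = 0 := by
        linear_combination e1 + im * e2 + b (x k) y * him
      simpa using this
    have h2 : ∀ k, b (x k) y = 0 := fun k => by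
      by_cases hk : k ≤ t
      · exact h1 k hk
      · obtain ⟨l, rfl⟩ := Nat.exists_eq_add_of_lt (not_le.mp hk)
        have : x (t + l + 1) = 0 := by
          simp only [hx]
          rw [show t + l + 1 = l + (t + 1) by ring, pow_add, Module.End.mul_apply]
          simp [hv₁]
        simp [this]
    rw [← hT, hTN]
    simp only [hu, map_sub, map_smul, LinearMap.sub_apply, LinearMap.smul_apply, smul_eq_mul,
      map_add, LinearMap.add_apply, hNx, h2]
    simp

end CanonicalForm
end CorankOne

namespace CorankOne

/-! ### Orthogonal block decomposition and the normal form of a pair of symmetric forms. -/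

section Decomposition

/-- Orthogonal decomposition of a self-adjoint operator into symmetric Jordan blocks. -/
theorem exists_blocks {K : Type*} [Field K] [IsAlgClosed K] [CharZero K] {im : K}
    (him : im ^ 2 = -1) (d : ℕ) :
    ∀ {V : Type*} [AddCommGroup V] [Module K V] [FiniteDimensional K V],
    Module.finrank K V = d → ∀ (b : LinearMap.BilinForm K V),
    (∀ x y, b x y = b y x) → (∀ x, (∀ y, b x y = 0) → x = 0) → ∀ (T : Module.End K V),
    (∀ x y, b (T x) y = b x (T y)) →
    ∃ (r : ℕ) (s : Fin r → ℕ) (c : Fin r → K) (w : (k : Fin r) → Fin (s k) → V),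
      ∑ k, s k = d ∧ (∀ k, 0 < s k) ∧
      (∀ k p q, b (w k p) (w k q) = if p = q then 1 else 0) ∧
      (∀ k p q, b (w k p) (T (w k q)) = symmBlock im (s k) (c k) p q) ∧
      ∀ k l, k ≠ l → ∀ p q, b (w k p) (w l q) = 0 ∧ b (w k p) (T (w l q)) = 0 := by
  induction d using Nat.strong_induction_on with
  | _ d ih =>
  intro V _ _ _ hd b hs hb T hT
  rcases subsingleton_or_nontrivial V with hV | hV
  · refine ⟨0, Fin.elim0, Fin.elim0, fun k => k.elim0, ?_, fun k => k.elim0, fun k => k.elim0,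
      fun k => k.elim0, fun k => k.elim0⟩
    rw [← hd, Module.finrank_zero_of_subsingleton]
    simp
  obtain ⟨s₀, c₀, u, hs₀, hu, huT, hinv⟩ := exists_symmBlock him hs hb hT
  -- The coordinates along the orthonormal block. The kernel is its orthogonal complement,
  -- `T`-invariant by `hinv`, and the induction continues there.
  let f : V →ₗ[K] (Fin s₀ → K) := LinearMap.pi fun q => b (u q)
  have hf : ∀ y, y ∈ LinearMap.ker f ↔ ∀ q, b (u q) y = 0 := fun y => by
    simp [f, LinearMap.mem_ker, funext_iff]
  have hproj : ∀ g : Fin s₀ → K, f (∑ q, g q • u q) = g := fun g => by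
    ext p
    simp [f, hu]
  have hsurj : LinearMap.range f = ⊤ :=
    LinearMap.range_eq_top.mpr fun g => ⟨_, hproj g⟩
  have hdim : Module.finrank K (LinearMap.ker f) + s₀ = d := by
    have h1 := f.finrank_range_add_finrank_ker
    rw [hsurj, finrank_top, Module.finrank_fin_fun, hd] at h1
    omega
  let T' : Module.End K (LinearMap.ker f) := T.restrict fun y hy =>
    (hf _).mpr (hinv y ((hf y).mp hy))
  obtain ⟨r, s, c, w, hsum, hpos, hw, hwT, hoff⟩ := ih (Module.finrank K (LinearMap.ker f))
    (by omega) rfl (b.restrict (LinearMap.ker f)) (fun x y => hs x y) (by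
      intro x hx
      refine Subtype.ext (hb x fun z => ?_)
      have h1 : z - ∑ q, f z q • u q ∈ LinearMap.ker f := by
        rw [LinearMap.mem_ker, map_sub, hproj, sub_self]
      have h2 : b x (z - ∑ q, f z q • u q) = 0 := hx ⟨_, h1⟩
      have h3 : ∀ q, b (x : V) (u q) = 0 := fun q => by rw [hs]; exact (hf x).mp x.2 q
      simpa [h3] using h2) T' (fun x y => hT x y)
  have hort : ∀ (q : Fin s₀) (k : Fin r) (p : Fin (s k)),
      b (u q) (w k p) = 0 ∧ b (u q) (T (w k p)) = 0 := fun q k p =>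
    ⟨(hf _).mp (w k p).2 q, hinv _ ((hf _).mp (w k p).2) q⟩
  refine ⟨r + 1, Fin.cons s₀ s, Fin.cons c₀ c,
    Fin.cons (α := fun k => Fin ((Fin.cons s₀ s : Fin (r + 1) → ℕ) k) → V) u
      (fun k p => (w k p : V)), ?_, ?_, ?_, ?_, ?_⟩
  · rw [Fin.sum_univ_succ]
    simp only [Fin.cons_zero, Fin.cons_succ, hsum]
    omega
  · exact Fin.cases hs₀ hpos
  · exact Fin.cases hu hw
  · exact Fin.cases huT hwT
  · refine Fin.cases (Fin.cases (fun h => absurd rfl h) fun l _ p q => hort p l q) fun k =>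
      Fin.cases (fun _ p q => ?_) fun l hkl p q =>
        hoff k l (fun h => hkl (congrArg Fin.succ h)) p q
    constructor
    · exact (hs _ _).trans (hort q k p).1
    · exact (hT _ _).symm.trans ((hs _ _).trans (hort q k p).2)

/-- A nondegenerate symmetric bilinear form `b` has an orthonormal basis in which another symmetric
bilinear form `g` has canonical matrix. -/
theorem exists_orthonormal_isCanonical {K V : Type*} [Field K] [IsAlgClosed K] [CharZero K] {im : K}
    (him : im ^ 2 = -1) [AddCommGroup V] [Module K V] [FiniteDimensional K V] {m : ℕ}
    (hm : Module.finrank K V = m) {b g : LinearMap.BilinForm K V}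
    (hs : ∀ x y, b x y = b y x) (hb : ∀ x, (∀ y, b x y = 0) → x = 0)
    (hg : ∀ x y, g x y = g y x) :
    ∃ w : Fin m → V, (∀ i j, b (w i) (w j) = if i = j then 1 else 0) ∧
      IsCanonical im (Matrix.of fun i j => g (w i) (w j)) := by
  have hb' : b.Nondegenerate := ⟨hb, fun y hy => hb y fun x => (hs y x).trans (hy x)⟩
  -- The operator representing `g` through `b`; symmetry of `g` makes it self-adjoint.
  let T : Module.End K V := (b.toDual hb').symm.toLinearMap ∘ₗ g
  have hT : ∀ x y, b (T x) y = g x y := fun x y =>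
    LinearMap.BilinForm.apply_toDual_symm_apply (hB := hb') (g x) y
  have hT' : ∀ x y, b x (T y) = g x y := fun x y => by rw [hs, hT, hg]
  obtain ⟨r, s, c, w, hsum, hpos, hw, hwT, hoff⟩ := exists_blocks him m hm b hs hb T
    fun x y => by rw [hT, hT']
  let ε : (Σ k, Fin (s k)) ≃ Fin m := finSigmaFinEquiv.trans (finCongr hsum)
  let w₁ : (Σ k, Fin (s k)) → V := fun x => w x.1 x.2
  have hw₁ : ∀ k p, w₁ (ε.symm (ε ⟨k, p⟩)) = w k p := fun k p => by rw [ε.symm_apply_apply]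
  refine ⟨fun i => w₁ (ε.symm i), fun i j => ?_, r, s, c, hsum, hpos, ?_⟩
  · obtain ⟨⟨k, p⟩, rfl⟩ := ε.surjective i
    obtain ⟨⟨l, q⟩, rfl⟩ := ε.surjective j
    simp only [hw₁, EmbeddingLike.apply_eq_iff_eq]
    by_cases h : k = l
    · subst h
      simp [hw]
    · simp [h, (hoff k l h p q).1]
  · ext i j
    obtain ⟨⟨k, p⟩, rfl⟩ := ε.surjective i
    obtain ⟨⟨l, q⟩, rfl⟩ := ε.surjective j
    change _ = Matrix.blockDiagonal' (fun k => symmBlock im (s k) (c k))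
      (ε.symm (ε ⟨k, p⟩)) (ε.symm (ε ⟨l, q⟩))
    simp only [Matrix.of_apply, hw₁]
    rw [ε.symm_apply_apply, ε.symm_apply_apply]
    by_cases h : k = l
    · subst h
      rw [Matrix.blockDiagonal'_apply_eq, ← hwT, hT']
    · rw [Matrix.blockDiagonal'_apply_ne _ _ _ h, ← hT', (hoff k l h p q).2]

end Decomposition
end CorankOne

namespace CorankOne

/-! ### Multiplication in `W` and the kernel of `F`. -/

section LocalAlgebra

variable {K R : Type*} [Field K] [CommRing R] [IsLocalRing R] [Algebra K R]

/-- The residue field is finite over the algebraically closed field `K`, hence equal to it. -/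
theorem exists_sub_algebraMap_mem_maximalIdeal [IsAlgClosed K] [FiniteDimensional K R] (x : R) :
    ∃ t : K, x - algebraMap K R t ∈ IsLocalRing.maximalIdeal R := by
  obtain ⟨t, ht⟩ := (IsAlgClosed.algebraMap_bijective_of_isIntegral
    (k := K) (K := IsLocalRing.ResidueField R)).2 (IsLocalRing.residue R x)
  refine ⟨t, ?_⟩
  rw [← IsLocalRing.residue_eq_zero_iff, map_sub, ← ht, sub_eq_zero]
  rfl

theorem one_notMem_restrictScalars_maximalIdeal :
    (1 : R) ∉ (IsLocalRing.maximalIdeal R).restrictScalars K := fun h =>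
  (IsLocalRing.mem_maximalIdeal _).mp h isUnit_one

theorem finrank_maximalIdeal_add_one [IsAlgClosed K] [FiniteDimensional K R] :
    Module.finrank K (IsLocalRing.maximalIdeal R) + 1 = Module.finrank K R := by
  have h1 : Module.finrank K (IsLocalRing.maximalIdeal R)
      = Module.finrank K ((IsLocalRing.maximalIdeal R).restrictScalars K) := rfl
  have h2 := Submodule.finrank_sup_add_finrank_inf_eq
    ((IsLocalRing.maximalIdeal R).restrictScalars K) (K ∙ (1 : R))
  have h3 : (IsLocalRing.maximalIdeal R).restrictScalars K ⊓ (K ∙ (1 : R)) = ⊥ :=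
    (Submodule.disjoint_span_singleton' one_ne_zero).mpr
      one_notMem_restrictScalars_maximalIdeal |>.eq_bot
  have h4 : (IsLocalRing.maximalIdeal R).restrictScalars K ⊔ (K ∙ (1 : R)) = ⊤ := by
    refine eq_top_iff.mpr fun x _ => ?_
    obtain ⟨t, ht⟩ := exists_sub_algebraMap_mem_maximalIdeal (K := K) x
    refine Submodule.mem_sup.mpr ⟨_, ht, algebraMap K R t, ?_, by ring⟩
    exact Submodule.mem_span_singleton.mpr ⟨t, (Algebra.algebraMap_eq_smul_one t).symm⟩
  rw [h3, h4, finrank_top, finrank_bot, finrank_span_singleton one_ne_zero] at h2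
  rw [h1]
  omega

/-- An invariant form of corank one on a local algebra of dimension `n + 2`, with respect to
a hyperplane `W` in the maximal ideal. -/
structure IsCorankOnePair (n : ℕ) (F : LinearMap.BilinForm K R) (W : Submodule K R) : Prop where
  two_le : 2 ≤ n
  finrank_eq : Module.finrank K R = n + 2
  symm : ∀ x y, F x y = F y x
  rank_eq : Module.finrank K (LinearMap.range F) = n + 1
  apply_one_one : F 1 1 = 0
  le_maximalIdeal : W ≤ (IsLocalRing.maximalIdeal R).restrictScalars K
  finrank_add_one : Module.finrank K W + 1 = Module.finrank K (IsLocalRing.maximalIdeal R)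
  invariant : IsInvariant W F

namespace IsCorankOnePair

variable {n : ℕ} {F : LinearMap.BilinForm K R} {W : Submodule K R}

theorem finiteDimensional (h : IsCorankOnePair n F W) : FiniteDimensional K R :=
  Module.finite_of_finrank_pos (by rw [h.finrank_eq]; omega)

theorem move (h : IsCorankOnePair n F W) {a : R} (ha : a ∈ W) (x y : R) :
    F (a * x) y = -F x (a * y) :=
  eq_neg_of_add_eq_zero_left (h.invariant a ha x y)

theorem apply_eq_neg (h : IsCorankOnePair n F W) {a : R} (ha : a ∈ W) (x : R) :
    F a x = -F 1 (a * x) := by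
  simpa using h.move ha 1 x

theorem finrank_W [IsAlgClosed K] (h : IsCorankOnePair n F W) : Module.finrank K W = n := by
  have := h.finiteDimensional
  have h1 := finrank_maximalIdeal_add_one (K := K) (R := R)
  have h2 := h.finrank_eq
  have h3 := h.finrank_add_one
  omega

theorem finrank_ker (h : IsCorankOnePair n F W) : Module.finrank K (LinearMap.ker F) = 1 := by
  have := h.finiteDimensional
  have h1 := F.finrank_range_add_finrank_ker
  rw [h.rank_eq, h.finrank_eq] at h1
  omega

variable [CharZero K]

theorem apply_one (h : IsCorankOnePair n F W) {a : R} (ha : a ∈ W) : F 1 a = 0 := by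
  have h1 := h.apply_eq_neg ha 1
  rw [h.symm a 1, mul_one] at h1
  have h2 : (2 : K) * F 1 a = 0 := by linear_combination h1
  simpa using h2

/-- Carrying three factors across `F` changes the sign three times, while symmetry returns the same
value. -/
theorem apply_one_mul_mul (h : IsCorankOnePair n F W) {a b c : R} (ha : a ∈ W) (hb : b ∈ W)
    (hc : c ∈ W) : F 1 (a * b * c) = 0 := by
  have h1 := h.move hb a c
  rw [h.apply_eq_neg ha, h.symm, h.apply_eq_neg hc, show c * (b * a) = a * b * c by ring,
    ← mul_assoc] at h1
  have h2 : (2 : K) * F 1 (a * b * c) = 0 := by linear_combination -h1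
  simpa using h2

/-- Otherwise, by rescaling and polarization, `W` together with `1` spans a totally isotropic
hyperplane `P`. For `u ∉ P` the space `P ∩ u^⊥` has dimension at least `n ≥ 2` and lies in the
one-dimensional kernel. -/
theorem exists_apply_one_sq [IsAlgClosed K] (h : IsCorankOnePair n F W) :
    ∃ a ∈ W, F 1 (a * a) = 1 := by
  have := h.finiteDimensional
  by_contra! hcon
  have h0 : ∀ a ∈ W, F 1 (a * a) = 0 := fun a ha => by
    by_contra hne
    obtain ⟨r, hr⟩ := IsAlgClosed.exists_pow_nat_eq (F 1 (a * a))⁻¹ (n := 2) (by norm_num)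
    refine hcon (r • a) (W.smul_mem r ha) ?_
    rw [smul_mul_smul_comm, map_smul, smul_eq_mul, ← pow_two, hr, inv_mul_cancel₀ hne]
  have hWW : ∀ a ∈ W, ∀ b ∈ W, F a b = 0 := fun a ha b hb => by
    rw [h.apply_eq_neg ha, neg_eq_zero]
    exact apply_eq_zero_of_diag_eq_zero (B := fun x y => F 1 (x * y)) (S := W)
      (fun x y => by rw [mul_comm]) (fun x y z => by rw [add_mul, map_add]) h0 ha hb
  have h1m := one_notMem_restrictScalars_maximalIdeal (K := K) (R := R)
  set P := W ⊔ (K ∙ (1 : R)) with hP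
  have hPdim : Module.finrank K P = n + 1 := by
    have h2 := Submodule.finrank_sup_add_finrank_inf_eq W (K ∙ (1 : R))
    have h3 : W ⊓ (K ∙ (1 : R)) = ⊥ :=
      ((Submodule.disjoint_span_singleton' one_ne_zero).mpr
        fun h1 => h1m (h.le_maximalIdeal h1)).eq_bot
    rw [h3, finrank_bot, finrank_span_singleton one_ne_zero, h.finrank_W] at h2
    simpa using h2
  have hPP : ∀ x ∈ P, ∀ y ∈ P, F x y = 0 := by
    intro x hx y hy
    obtain ⟨a, ha, s, hs, rfl⟩ := Submodule.mem_sup.mp hx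
    obtain ⟨b, hb, t, ht, rfl⟩ := Submodule.mem_sup.mp hy
    obtain ⟨s, rfl⟩ := Submodule.mem_span_singleton.mp hs
    obtain ⟨t, rfl⟩ := Submodule.mem_span_singleton.mp ht
    simp [hWW a ha b hb, h.apply_one hb, h.symm a 1, h.apply_one ha, h.apply_one_one]
  -- `P` is isotropic of codimension one, so `P ⊓ u^⊥` lies in the kernel of `F`
  obtain ⟨u, hu⟩ : ∃ u, u ∉ P := by
    by_contra! hall
    rw [Submodule.eq_top_iff'.mpr hall, finrank_top, h.finrank_eq] at hPdim
    omega
  have hsup : P ⊔ (K ∙ u) = ⊤ := by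
    refine Submodule.eq_top_of_finrank_eq ?_
    have h2 := Submodule.finrank_sup_add_finrank_inf_eq P (K ∙ u)
    have hu0 : u ≠ 0 := fun h => hu (h ▸ P.zero_mem)
    rw [((Submodule.disjoint_span_singleton' hu0).mpr hu).eq_bot, finrank_bot,
      finrank_span_singleton hu0] at h2
    rw [h.finrank_eq]
    omega
  have hle : P ⊓ LinearMap.ker (F u) ≤ LinearMap.ker F := by
    rintro x ⟨hxP, hxu⟩
    refine LinearMap.mem_ker.mpr (LinearMap.ext fun z => ?_)
    obtain ⟨p, hp, v, hv, rfl⟩ := Submodule.mem_sup.mp (hsup ▸ Submodule.mem_top : z ∈ P ⊔ (K ∙ u))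
    obtain ⟨t, rfl⟩ := Submodule.mem_span_singleton.mp hv
    rw [map_add, map_smul, hPP x hxP p hp, h.symm x u, LinearMap.mem_ker.mp hxu]
    simp
  have h4 := Submodule.finrank_mono hle
  rw [h.finrank_ker] at h4
  have h5 := Submodule.finrank_sup_add_finrank_inf_eq P (LinearMap.ker (F u))
  have h6 := (F u).finrank_range_add_finrank_ker
  have h7 : Module.finrank K (LinearMap.range (F u)) ≤ 1 :=
    (Submodule.finrank_le _).trans (by simp)
  have h8 := Submodule.finrank_le (P ⊔ LinearMap.ker (F u))
  have h9 := h.finrank_eq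
  have h10 := h.two_le
  omega

/-- The functional `F 1` vanishes on `W` but not at `a * a`, so it cuts out a hyperplane of the
maximal ideal containing `W`; dimensions agree. -/
theorem mem_iff (h : IsCorankOnePair n F W) {a : R} (ha : a ∈ W) (ha1 : F 1 (a * a) = 1) {x : R} :
    x ∈ W ↔ x ∈ IsLocalRing.maximalIdeal R ∧ F 1 x = 0 := by
  have := h.finiteDimensional
  have hle : W ≤ (IsLocalRing.maximalIdeal R).restrictScalars K ⊓ LinearMap.ker (F 1) :=
    fun y hy => ⟨h.le_maximalIdeal hy, h.apply_one hy⟩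
  have hlt : (IsLocalRing.maximalIdeal R).restrictScalars K ⊓ LinearMap.ker (F 1)
      < (IsLocalRing.maximalIdeal R).restrictScalars K := by
    refine lt_of_le_of_ne inf_le_left fun heq => ?_
    have h1 : a * a ∈ (IsLocalRing.maximalIdeal R).restrictScalars K :=
      Ideal.mul_mem_left _ _ (h.le_maximalIdeal ha)
    rw [← heq] at h1
    have h2 : F 1 (a * a) = 0 := h1.2
    rw [ha1] at h2
    exact one_ne_zero h2
  have h2 := Submodule.finrank_lt_finrank_of_lt hlt
  have h3 := h.finrank_add_one
  have h4 : Module.finrank K (IsLocalRing.maximalIdeal R)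
      = Module.finrank K ((IsLocalRing.maximalIdeal R).restrictScalars K) := rfl
  have h5 : W = _ := Submodule.eq_of_le_of_finrank_le hle (by omega)
  conv_lhs => rw [h5]
  rfl

/-- `R` is spanned by `1`, `W` and `a * a`. -/
theorem exists_decomposition [IsAlgClosed K] (h : IsCorankOnePair n F W) {a : R} (ha : a ∈ W)
    (ha1 : F 1 (a * a) = 1) (x : R) :
    ∃ (s t : K), ∃ w ∈ W, x = s • 1 + w + t • (a * a) := by
  have := h.finiteDimensional
  obtain ⟨s, hs⟩ := exists_sub_algebraMap_mem_maximalIdeal (K := K) x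
  rw [Algebra.algebraMap_eq_smul_one] at hs
  refine ⟨s, F 1 x, x - s • 1 - F 1 x • (a * a), (h.mem_iff ha ha1).mpr ⟨?_, ?_⟩, by abel⟩
  · refine sub_mem hs ?_
    exact ((IsLocalRing.maximalIdeal R).restrictScalars K).smul_mem _
      (Ideal.mul_mem_left _ _ (h.le_maximalIdeal ha))
  · simp [ha1, h.apply_one_one]

theorem mul_mul_mem (h : IsCorankOnePair n F W) {a b c d : R} (hd : d ∈ W) (hd1 : F 1 (d * d) = 1)
    (ha : a ∈ W) (hb : b ∈ W) (hc : c ∈ W) : a * b * c ∈ W :=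
  (h.mem_iff hd hd1).mpr
    ⟨Ideal.mul_mem_left _ _ (h.le_maximalIdeal hc), h.apply_one_mul_mul ha hb hc⟩

/-- Call the element `w`. As a combination of products of two elements of `W` it satisfies `F w y =
F 1 (w * y)`; as an element of `W`, `F w y = -F 1 (w * y)`. -/
theorem mul_sub_mem_ker (h : IsCorankOnePair n F W) {a b c : R} (ha : a ∈ W)
    (ha1 : F 1 (a * a) = 1) (hb : b ∈ W) (hc : c ∈ W) :
    b * c - F 1 (b * c) • (a * a) ∈ LinearMap.ker F := by
  set w := b * c - F 1 (b * c) • (a * a) with hw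
  have hwW : w ∈ W := by
    refine (h.mem_iff ha ha1).mpr ⟨sub_mem (Ideal.mul_mem_left _ _ (h.le_maximalIdeal hc)) ?_, ?_⟩
    · exact ((IsLocalRing.maximalIdeal R).restrictScalars K).smul_mem _
        (Ideal.mul_mem_left _ _ (h.le_maximalIdeal ha))
    · simp [hw, ha1]
  have hsa : ∀ {p q : R}, p ∈ W → q ∈ W → ∀ y, F (p * q) y = F 1 (p * q * y) :=
    fun {p q} hp hq y => by
      rw [h.move hp, h.apply_eq_neg hq, neg_neg, show q * (p * y) = p * q * y by ring]
  refine LinearMap.mem_ker.mpr (LinearMap.ext fun y => ?_)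
  have h1 : F w y = F 1 (w * y) := by
    simp only [hw, map_sub, map_smul, LinearMap.sub_apply, LinearMap.smul_apply, hsa hb hc,
      hsa ha ha, sub_mul, smul_mul_assoc]
  have h2 := h.apply_eq_neg hwW y
  have h3 : (2 : K) * F w y = 0 := by linear_combination h1 + h2
  simpa using h3

theorem mul_mem_ker [IsAlgClosed K] (h : IsCorankOnePair n F W) {z : R}
    (hz : z ∈ LinearMap.ker F) (x : R) : x * z ∈ LinearMap.ker F := by
  obtain ⟨a, ha, ha1⟩ := h.exists_apply_one_sq
  have hW : ∀ {b z : R}, b ∈ W → z ∈ LinearMap.ker F → b * z ∈ LinearMap.ker F :=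
    fun {b z} hb hz => LinearMap.mem_ker.mpr (LinearMap.ext fun y => by
      rw [h.move hb, LinearMap.mem_ker.mp hz]; simp)
  obtain ⟨s, t, w, hw, rfl⟩ := h.exists_decomposition ha ha1 x
  rw [add_mul, add_mul, smul_mul_assoc, smul_mul_assoc, one_mul, mul_assoc]
  exact add_mem (add_mem (Submodule.smul_mem _ _ hz) (hW hw hz))
    (Submodule.smul_mem _ _ (hW ha (hW ha hz)))

/-- The kernel is an ideal and a line, so `x` acts on it by a scalar `t`. If `t ≠ 0`, then `x - t`
is a unit annihilating `z`. -/
theorem mul_eq_zero_of_mem_ker [IsAlgClosed K] (h : IsCorankOnePair n F W) {z : R}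
    (hz : z ∈ LinearMap.ker F) {x : R} (hx : x ∈ IsLocalRing.maximalIdeal R) : x * z = 0 := by
  by_cases hz0 : z = 0
  · rw [hz0, mul_zero]
  obtain ⟨t, ht⟩ := (finrank_eq_one_iff_of_nonzero' (⟨z, hz⟩ : LinearMap.ker F)
    (fun h0 => hz0 (congrArg Subtype.val h0))).mp h.finrank_ker ⟨x * z, h.mul_mem_ker hz x⟩
  have ht' : t • z = x * z := congrArg Subtype.val ht
  by_cases ht0 : t = 0
  · rw [← ht', ht0, zero_smul]
  exfalso
  have hu : IsUnit (x - algebraMap K R t) := by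
    by_contra hn
    have h1 := sub_mem hx ((IsLocalRing.mem_maximalIdeal _).mpr hn)
    rw [sub_sub_cancel] at h1
    exact (IsLocalRing.mem_maximalIdeal _).mp h1 ((IsUnit.mk0 t ht0).map (algebraMap K R))
  refine hz0 (hu.mul_right_eq_zero.mp ?_)
  rw [sub_mul, ← ht', Algebra.smul_def, sub_self]

theorem ker_le [IsAlgClosed K] (h : IsCorankOnePair n F W) : LinearMap.ker F ≤ W := by
  intro z hz
  obtain ⟨a, ha, ha1⟩ := h.exists_apply_one_sq
  refine (h.mem_iff ha ha1).mpr ⟨?_, by rw [h.symm, LinearMap.mem_ker.mp hz]; rfl⟩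
  refine (IsLocalRing.mem_maximalIdeal _).mpr fun hu => ?_
  have h1 := h.mul_eq_zero_of_mem_ker hz (h.le_maximalIdeal ha)
  rw [hu.mul_left_eq_zero.mp h1] at ha1
  simp at ha1

/-- Put `t = F 1 (a ^ 4)`. Applied to `a` and `a ^ 3`, `mul_sub_mem_ker` places `(a ^ 2 - t) * a ^
2` in the kernel. If `t ≠ 0` the first factor is a unit, so `a ^ 2` is in the kernel, against `F 1
(a * a) = 1`. -/
theorem apply_one_pow_four [IsAlgClosed K] (h : IsCorankOnePair n F W) {a : R} (ha : a ∈ W)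
    (ha1 : F 1 (a * a) = 1) : F 1 (a * a * (a * a)) = 0 := by
  by_contra ht0
  have h1 := h.mul_sub_mem_ker ha ha1 ha (h.mul_mul_mem ha ha1 ha ha ha)
  rw [show a * (a * a * a) = a * a * (a * a) by ring] at h1
  set t := F 1 (a * a * (a * a))
  have hu : IsUnit (a * a - algebraMap K R t) := by
    by_contra hn
    have h2 := sub_mem (Ideal.mul_mem_left _ a (h.le_maximalIdeal ha))
      ((IsLocalRing.mem_maximalIdeal _).mpr hn)
    rw [sub_sub_cancel] at h2
    exact (IsLocalRing.mem_maximalIdeal _).mp h2 ((IsUnit.mk0 t ht0).map (algebraMap K R))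
  obtain ⟨y, hy⟩ := hu.exists_left_inv
  have h3 := h.mul_mem_ker h1 y
  rw [Algebra.smul_def, ← sub_mul, ← mul_assoc, hy, one_mul] at h3
  rw [h.symm, LinearMap.mem_ker.mp h3] at ha1
  simp at ha1

theorem cube_mem_ker [IsAlgClosed K] (h : IsCorankOnePair n F W) {a : R} (ha : a ∈ W)
    (ha1 : F 1 (a * a) = 1) : a * a * a ∈ LinearMap.ker F := by
  have h3 := h.mul_mul_mem ha ha1 ha ha ha
  refine LinearMap.mem_ker.mpr (LinearMap.ext fun y => ?_)
  obtain ⟨s, t, w, hw, rfl⟩ := h.exists_decomposition ha ha1 y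
  have e1 : F (a * a * a) 1 = 0 := by rw [h.symm, h.apply_one h3]
  -- Modulo the kernel, `a * w` is a multiple of `a * a`; multiplication by `a * a` kills the
  -- kernel, so `a ^ 3 * w` is a multiple of `a ^ 4`.
  have e2 : F (a * a * a) w = 0 := by
    have hκ := h.mul_sub_mem_ker ha ha1 ha hw
    have h0 := h.mul_eq_zero_of_mem_ker hκ (Ideal.mul_mem_left _ a (h.le_maximalIdeal ha))
    rw [mul_sub, sub_eq_zero, mul_smul_comm] at h0
    rw [h.apply_eq_neg h3, mul_assoc, h0, map_smul, h.apply_one_pow_four ha ha1]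
    simp
  have e3 : F (a * a * a) (a * a) = 0 := by
    rw [h.apply_eq_neg h3, show a * a * a * (a * a) = a * a * (a * a * a) by ring,
      h.apply_one_mul_mul ha ha h3, neg_zero]
  simp [e1, e2, e3]

end IsCorankOnePair
end LocalAlgebra
end CorankOne

namespace CorankOne

/-! ### The adapted basis and the matrix of `F`. -/

namespace IsCorankOnePair

variable {K R : Type*} [Field K] [IsAlgClosed K] [CharZero K] [CommRing R] [IsLocalRing R]
  [Algebra K R] {n : ℕ} {F : LinearMap.BilinForm K R} {W : Submodule K R}

/-- Vectors of `W` that are orthonormal for `F 1 (x * y)` and whose products are put into canonical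
form by a linear functional `g`. -/
theorem exists_orthonormal_family (h : IsCorankOnePair n F W) {im : K} (him : im ^ 2 = -1)
    (g : Module.Dual K R) :
    ∃ w : Fin (n - 1) → R, (∀ i, w i ∈ W) ∧
      (∀ i j, F 1 (w i * w j) = if i = j then 1 else 0) ∧
      IsCanonical im (Matrix.of fun i j => g (w i * w j)) := by
  have := h.finiteDimensional
  obtain ⟨a, ha, ha1⟩ := h.exists_apply_one_sq
  obtain ⟨C', hC'⟩ := Submodule.exists_isCompl (LinearMap.ker F)
  -- By the modular law `C` complements the kernel inside `W`. It has dimension `n - 1`, and the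
  -- product form is nondegenerate on it.
  set C := C' ⊓ W with hC
  have hinf : LinearMap.ker F ⊓ C = ⊥ :=
    le_bot_iff.mp (hC'.inf_eq_bot ▸ inf_le_inf_left _ inf_le_left)
  have hsup : LinearMap.ker F ⊔ C = W := by
    rw [hC, ← sup_inf_assoc_of_le _ h.ker_le, hC'.sup_eq_top, top_inf_eq]
  have hdim : Module.finrank K C = n - 1 := by
    have h1 := Submodule.finrank_sup_add_finrank_inf_eq (LinearMap.ker F) C
    rw [hinf, hsup, finrank_bot, h.finrank_W, h.finrank_ker] at h1
    omega
  let β (l : Module.Dual K R) : LinearMap.BilinForm K R := (LinearMap.mul K R).compr₂ l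
  obtain ⟨w, hw, hcan⟩ := exists_orthonormal_isCanonical him hdim
    (b := (β (F 1)).restrict C) (g := (β g).restrict C)
    (fun x y => congrArg (F 1) (mul_comm (x : R) y)) (by
      intro x hx
      have hxW : (x : R) ∈ W := x.2.2
      have hxC : ∀ y ∈ C, F 1 (x * y) = 0 := fun y hy => hx ⟨y, hy⟩
      have hxk : (x : R) ∈ LinearMap.ker F := by
        refine LinearMap.mem_ker.mpr (LinearMap.ext fun y => ?_)
        obtain ⟨s, t, v, hv, rfl⟩ := h.exists_decomposition ha ha1 y
        obtain ⟨z, hz, c, hc, rfl⟩ := Submodule.mem_sup.mp (hsup ▸ hv)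
        have e1 : F x 1 = 0 := by rw [h.symm, h.apply_one hxW]
        have e2 : F x (a * a) = 0 := by
          rw [h.apply_eq_neg hxW, ← mul_assoc, h.apply_one_mul_mul hxW ha ha, neg_zero]
        have e3 : F x z = 0 := by rw [h.symm, LinearMap.mem_ker.mp hz]; rfl
        have e4 : F x c = 0 := by rw [h.apply_eq_neg hxW, hxC c hc, neg_zero]
        simp [e1, e2, e3, e4]
      have h0 : (x : R) ∈ LinearMap.ker F ⊓ C := ⟨hxk, x.2⟩
      rw [hinf] at h0
      exact Subtype.ext h0)
    (fun x y => congrArg g (mul_comm (x : R) y))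
  exact ⟨fun i => w i, fun i => (w i).2.2, hw, hcan⟩

/-- The basis built from an orthonormal family of `W` and a generator of the kernel of `F`. -/
theorem exists_basis {m : ℕ} (h : IsCorankOnePair (m + 1) F W) {w : Fin m → R} (hw : ∀ i, w i ∈ W)
    (hww : ∀ i j, F 1 (w i * w j) = if i = j then 1 else 0) {z : R} (hz : z ∈ LinearMap.ker F)
    (hz0 : z ≠ 0) (i₀ : Fin m) :
    ∃ e : Module.Basis (Fin (m + 1 + 2)) K R, e 0 = 1 ∧
      (∀ i : Fin m, e i.castSucc.castSucc.succ = w i) ∧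
      e (Fin.last m).castSucc.succ = z ∧
      e (Fin.last (m + 1 + 1)) = w i₀ * w i₀ ∧
      W = Submodule.span K (Set.range fun i : Fin (m + 1) => e i.castSucc.succ) ∧
      (IsLocalRing.maximalIdeal R).restrictScalars K
        = Submodule.span K (Set.range fun i : Fin (m + 1 + 1) => e i.succ) ∧
      LinearMap.BilinForm.toMatrix e F = normalMatrix K (m + 1) := by
  have := h.finiteDimensional
  have ha := hw i₀
  have ha1 : F 1 (w i₀ * w i₀) = 1 := by simp [hww]
  set a := w i₀
  have hzW := h.ker_le hz
  have f1w : ∀ i, F 1 (w i) = 0 := fun i => h.apply_one (hw i)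
  have fw1 : ∀ i, F (w i) 1 = 0 := fun i => by rw [h.symm, f1w]
  have fz : ∀ x, F z x = 0 := fun x => by rw [LinearMap.mem_ker.mp hz]; rfl
  have fz' : ∀ x, F x z = 0 := fun x => by rw [h.symm, fz]
  have faa1 : F (a * a) 1 = 1 := by rw [h.symm, ha1]
  have fw : ∀ i j, F (w i) (w j) = -if i = j then 1 else 0 := fun i j => by
    rw [h.apply_eq_neg (hw i), hww]
  have fwa : ∀ i, F (w i) (a * a) = 0 := fun i => by
    rw [h.apply_eq_neg (hw i), ← mul_assoc, h.apply_one_mul_mul (hw i) ha ha, neg_zero]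
  have faw : ∀ i, F (a * a) (w i) = 0 := fun i => by rw [h.symm, fwa]
  have faa : F (a * a) (a * a) = 0 := by
    rw [h.move ha, h.apply_eq_neg ha, ← mul_assoc, h.apply_one_pow_four ha ha1]
    simp
  let v : Fin (m + 1 + 2) → R :=
    Fin.cons 1 (Fin.snoc (α := fun _ => R) (Fin.snoc (α := fun _ => R) w z) (a * a))
  have v0 : v 0 = 1 := rfl
  have vw : ∀ i : Fin m, v i.castSucc.castSucc.succ = w i := fun i => by simp [v]
  have vz : v (Fin.last m).castSucc.succ = z := by simp [v]
  have va : v (Fin.last (m + 1)).succ = a * a := by simp [v]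
  have va' : v (Fin.last (m + 1 + 1)) = a * a := va
  -- The vector `w i` has index `i + 1`, which must differ from the last index `m + 2`.
  have hne : ∀ i : Fin m, (i : ℕ) ≠ m + 1 := fun i => by omega
  -- Pairing a relation with `1`, `a * a` and the `w i` isolates every coefficient except that of
  -- `z`, which `F` does not see; it is read off last.
  have hli : LinearIndependent K v := by
    refine Fintype.linearIndependent_iff.mpr fun g hg => ?_
    rw [Fin.sum_univ_succ, Fin.sum_univ_castSucc, Fin.sum_univ_castSucc] at hg
    simp only [v0, vw, vz, va] at hg
    have g1 : g (Fin.last (m + 1)).succ = 0 := by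
      simpa [h.apply_one_one, f1w, fz', ha1] using congrArg (F 1) hg
    have g2 : g 0 = 0 := by
      simpa [faw, fz', faa1, faa] using congrArg (F (a * a)) hg
    have g3 : ∀ i : Fin m, g i.castSucc.castSucc.succ = 0 := fun i => by
      simpa [fw1, fz', fwa, fw] using congrArg (F (w i)) hg
    have g4 : g (Fin.last m).castSucc.succ = 0 := by
      simp only [g1, g2, g3, zero_smul, Finset.sum_const_zero, zero_add, add_zero] at hg
      exact (smul_eq_zero.mp hg).resolve_right hz0
    exact Fin.cases g2 (Fin.lastCases g1 (Fin.lastCases g4 g3))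
  have hvW : ∀ i : Fin (m + 1), v i.castSucc.succ ∈ W :=
    Fin.lastCases (by rwa [vz]) fun i => by rw [vw]; exact hw i
  have hvm : ∀ i : Fin (m + 1 + 1), v i.succ ∈ (IsLocalRing.maximalIdeal R).restrictScalars K :=
    Fin.lastCases (by rw [va]; exact Ideal.mul_mem_left _ _ (h.le_maximalIdeal ha))
      fun i => h.le_maximalIdeal (hvW i)
  have hcard : Fintype.card (Fin (m + 1 + 2)) = Module.finrank K R := by
    rw [Fintype.card_fin, h.finrank_eq]
  refine ⟨basisOfLinearIndependentOfCardEqFinrank hli hcard, ?_⟩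
  simp only [coe_basisOfLinearIndependentOfCardEqFinrank]
  refine ⟨v0, vw, vz, va, ?_, ?_, ?_⟩
  · symm
    refine Submodule.eq_of_le_of_finrank_eq (Submodule.span_le.mpr ?_) ?_
    · rintro _ ⟨i, rfl⟩
      exact hvW i
    · refine (finrank_span_eq_card (hli.comp (fun i : Fin (m + 1) => i.castSucc.succ)
        ((Fin.succ_injective _).comp (Fin.castSucc_injective _)))).trans ?_
      rw [h.finrank_W, Fintype.card_fin]
  · symm
    refine Submodule.eq_of_le_of_finrank_eq (Submodule.span_le.mpr ?_) ?_
    · rintro _ ⟨i, rfl⟩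
      exact hvm i
    · refine (finrank_span_eq_card (hli.comp _ (Fin.succ_injective _))).trans ?_
      rw [Fintype.card_fin]
      have h1 := finrank_maximalIdeal_add_one (K := K) (R := R)
      rw [h.finrank_eq] at h1
      change _ = Module.finrank K (IsLocalRing.maximalIdeal R)
      omega
  · ext i j
    rw [LinearMap.BilinForm.toMatrix_apply]
    simp only [coe_basisOfLinearIndependentOfCardEqFinrank, normalMatrix, Matrix.of_apply]
    induction i using Fin.cases with
    | zero =>
      induction j using Fin.cases with
      | zero => simp [v0, h.apply_one_one, Fin.ext_iff]
      | succ j =>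
        induction j using Fin.lastCases with
        | last => simp [v0, va', ha1, Fin.ext_iff]
        | cast j =>
          induction j using Fin.lastCases with
          | last => simp [v0, vz, fz', Fin.ext_iff]
          | cast j => simp [v0, vw, f1w, Fin.ext_iff, hne j]
    | succ i =>
      induction i using Fin.lastCases with
      | last =>
        induction j using Fin.cases with
        | zero => simp [v0, va', faa1, Fin.ext_iff]
        | succ j =>
          induction j using Fin.lastCases with
          | last => simp [va', faa, Fin.ext_iff]
          | cast j =>
            induction j using Fin.lastCases with
            | last => simp [va', vz, fz', Fin.ext_iff]
            | cast j => simp [va', vw, faw, Fin.ext_iff]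
      | cast i =>
        induction i using Fin.lastCases with
        | last =>
          rw [vz, fz, if_neg, if_neg]
          · rintro ⟨-, -, h3⟩
            simp at h3
          · rintro (⟨h1, -⟩ | ⟨h1, -⟩)
            · exact Fin.succ_ne_zero _ h1
            · simpa using congrArg Fin.val h1
        | cast i =>
          induction j using Fin.cases with
          | zero => simp [v0, vw, fw1, Fin.ext_iff, hne i]
          | succ j =>
            induction j using Fin.lastCases with
            | last => simp [va', vw, fwa, Fin.ext_iff, hne i]
            | cast j =>
              induction j using Fin.lastCases with
              | last => simp [vw, vz, fz', Fin.ext_iff, i.2.ne]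
              | cast j =>
                rcases eq_or_ne i j with rfl | hij
                · simp [vw, fw, Fin.ext_iff]
                · simp [vw, fw, Fin.ext_iff, hij, Fin.val_ne_of_ne hij]

end IsCorankOnePair

/-! ### Recognizing polynomial quotients by counting dimensions. -/

section Presentation

variable {K : Type*} [Field K]

/-- A presentation of an algebra can be checked on a subspace of the quotient which is small enough
and stable under multiplication by the variables. -/
theorem exists_quotient_algEquiv {R σ : Type*} [CommRing R] [Algebra K R]
    {I : Ideal (MvPolynomial σ K)} {f : MvPolynomial σ K →ₐ[K] R} (hI : ∀ p ∈ I, f p = 0)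
    (hf : Function.Surjective f) {S : Submodule K (MvPolynomial σ K ⧸ I)} [FiniteDimensional K S]
    (h1 : 1 ∈ S) (hX : ∀ s, ∀ q ∈ S, Ideal.Quotient.mk I (MvPolynomial.X s) * q ∈ S)
    (hdim : Module.finrank K S ≤ Module.finrank K R) :
    ∃ φ : (MvPolynomial σ K ⧸ I) ≃ₐ[K] R, ∀ p, φ (Ideal.Quotient.mk I p) = f p := by
  have hS : S = ⊤ := by
    refine eq_top_iff.mpr fun q _ => ?_
    obtain ⟨p, rfl⟩ := Ideal.Quotient.mk_surjective q
    induction p using MvPolynomial.induction_on with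
    | C c =>
      have : Ideal.Quotient.mk I (MvPolynomial.C c) = c • 1 := by
        rw [← MvPolynomial.algebraMap_eq, Ideal.Quotient.mk_algebraMap,
          Algebra.algebraMap_eq_smul_one]
      rw [this]
      exact S.smul_mem c h1
    | add p q hp hq =>
      rw [map_add]
      exact S.add_mem (hp trivial) (hq trivial)
    | mul_X p s hp =>
      rw [map_mul, mul_comm]
      exact hX s _ (hp trivial)
  subst hS
  have hfin : FiniteDimensional K (MvPolynomial σ K ⧸ I) :=
    Module.Finite.equiv (Submodule.topEquiv (R := K) (M := MvPolynomial σ K ⧸ I))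
  let φ : (MvPolynomial σ K ⧸ I) →ₐ[K] R := Ideal.Quotient.liftₐ I f hI
  have hφ : ∀ p, φ (Ideal.Quotient.mk I p) = f p := fun p => rfl
  have hsurj : Function.Surjective φ := fun r => by
    obtain ⟨p, rfl⟩ := hf r
    exact ⟨_, hφ p⟩
  have hfinR : FiniteDimensional K R := Module.Finite.of_surjective φ.toLinearMap hsurj
  have hle := LinearMap.finrank_le_finrank_of_surjective (f := φ.toLinearMap) hsurj
  rw [finrank_top] at hdim
  have hinj : Function.Injective φ :=
    (LinearMap.injective_iff_surjective_of_finrank_eq_finrank (f := φ.toLinearMap)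
      (le_antisymm hdim hle)).mpr hsurj
  exact ⟨AlgEquiv.ofBijective φ ⟨hinj, hsurj⟩, hφ⟩

/-- The span of `1`, the `v i`, `z` and `v i₀ * v i₀` is closed under multiplication by the `v i`
and `z`, given suitable relations. -/
theorem mul_mem_span {Q : Type*} [CommRing Q] [Algebra K Q] {m : ℕ} {v : Fin m → Q} {z : Q}
    {i₀ : Fin m} (hz : ∀ i, v i * z = 0) (hzz : z * z = 0)
    (hv : ∀ i j, ∃ c d : K, v i * v j = c • (v i₀ * v i₀) + d • z)
    (hcube : v i₀ * v i₀ * v i₀ = 0) {x : Q} (hx : x = z ∨ ∃ i, x = v i) {q : Q}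
    (hq : q ∈ Submodule.span K (Set.range v ∪ {1, z, v i₀ * v i₀})) :
    x * q ∈ Submodule.span K (Set.range v ∪ {1, z, v i₀ * v i₀}) := by
  set S := Submodule.span K (Set.range v ∪ {1, z, v i₀ * v i₀}) with hS
  have mz : z ∈ S := Submodule.subset_span (by simp)
  have ma : v i₀ * v i₀ ∈ S := Submodule.subset_span (by simp)
  have mv : ∀ i, v i ∈ S := fun i => Submodule.subset_span (by simp)
  induction hq using Submodule.span_induction with
  | zero => rw [mul_zero]; exact S.zero_mem
  | add p q _ _ hp hq => rw [mul_add]; exact S.add_mem hp hq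
  | smul c p _ hp => rw [mul_smul_comm]; exact S.smul_mem c hp
  | mem q hq =>
    rcases hx with rfl | ⟨i, rfl⟩
    · rcases hq with ⟨j, rfl⟩ | rfl | rfl | rfl
      · rw [mul_comm, hz]; exact S.zero_mem
      · rwa [mul_one]
      · rw [hzz]; exact S.zero_mem
      · rw [mul_comm, mul_assoc, hz, mul_zero]; exact S.zero_mem
    · rcases hq with ⟨j, rfl⟩ | rfl | rfl | rfl
      · obtain ⟨c, d, h⟩ := hv i j
        rw [h]
        exact S.add_mem (S.smul_mem c ma) (S.smul_mem d mz)
      · rw [mul_one]; exact mv i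
      · rw [hz]; exact S.zero_mem
      · obtain ⟨c, d, h⟩ := hv i i₀
        rw [← mul_assoc, h, add_mul, smul_mul_assoc, smul_mul_assoc, hcube, mul_comm z, hz]
        simp

theorem finrank_span_le {Q : Type*} [AddCommGroup Q] [Module K Q] {m : ℕ} (v : Fin m → Q)
    (x y z : Q) : Module.finrank K (Submodule.span K (Set.range v ∪ {x, y, z})) ≤ m + 3 := by
  classical
  have h1 := finrank_span_finset_le_card (R := K) (Finset.univ.image v ∪ {x, y, z})
  have h2 : ((Finset.univ.image v ∪ {x, y, z} : Finset Q) : Set Q) = Set.range v ∪ {x, y, z} := by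
    simp
  rw [← h2]
  refine h1.trans ((Finset.card_union_le _ _).trans (Nat.add_le_add ?_ Finset.card_le_three))
  exact Finset.card_image_le.trans (by simp)

end Presentation
end CorankOne

namespace CorankOne

section Presentation

variable {K R : Type*} [Field K] [CommRing R] [Algebra K R]

/-- Surjectivity holds because the last basis vector is the square of another one. The listed
relations reduce the quotient to the span of `m + 3` classes, which is the dimension of `R`. -/
theorem exists_algEquiv_of_relations {m : ℕ} (e : Module.Basis (Fin (m + 1 + 2)) K R)
    (he0 : e 0 = 1) {i₀ : Fin m}
    (hlast : e (Fin.last (m + 1 + 1)) = e i₀.castSucc.castSucc.succ * e i₀.castSucc.castSucc.succ)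
    {I : Ideal (MvPolynomial (Fin (m + 1)) K)}
    (hI : I ≤ RingHom.ker (MvPolynomial.aeval (R := K) fun i : Fin (m + 1) => e i.castSucc.succ))
    (hz : ∀ i : Fin m, (MvPolynomial.X i.castSucc * MvPolynomial.X (Fin.last m) :
      MvPolynomial (Fin (m + 1)) K) ∈ I)
    (hzz : (MvPolynomial.X (Fin.last m) * MvPolynomial.X (Fin.last m) :
      MvPolynomial (Fin (m + 1)) K) ∈ I)
    (hv : ∀ i j : Fin m, ∃ c d : K, MvPolynomial.X i.castSucc * MvPolynomial.X j.castSucc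
      - (MvPolynomial.C c * (MvPolynomial.X i₀.castSucc * MvPolynomial.X i₀.castSucc)
        + MvPolynomial.C d * MvPolynomial.X (Fin.last m)) ∈ I)
    (hcube : (MvPolynomial.X i₀.castSucc * MvPolynomial.X i₀.castSucc
      * MvPolynomial.X i₀.castSucc : MvPolynomial (Fin (m + 1)) K) ∈ I) :
    ∃ φ : (MvPolynomial (Fin (m + 1)) K ⧸ I) ≃ₐ[K] R,
      ∀ i, φ (Ideal.Quotient.mk I (MvPolynomial.X i)) = e i.castSucc.succ := by
  set f : MvPolynomial (Fin (m + 1)) K →ₐ[K] R := MvPolynomial.aeval fun i => e i.castSucc.succ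
  have hfX : ∀ i, f (MvPolynomial.X i) = e i.castSucc.succ := fun i => by simp [f]
  have hsurj : Function.Surjective f := by
    have h1 : ∀ k, e k ∈ f.range := by
      refine Fin.cases (he0 ▸ one_mem _) (Fin.lastCases ?_ fun i => ⟨_, hfX i⟩)
      change e (Fin.last (m + 1 + 1)) ∈ _
      rw [hlast]
      exact mul_mem ⟨_, hfX _⟩ ⟨_, hfX _⟩
    have h2 : Submodule.span K (Set.range e) ≤ Subalgebra.toSubmodule f.range :=
      Submodule.span_le.mpr (by rintro _ ⟨k, rfl⟩; exact h1 k)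
    intro r
    rw [e.span_eq] at h2
    exact h2 (Submodule.mem_top (x := r))
  have hmk : ∀ c : K, ∀ q, Ideal.Quotient.mk I (MvPolynomial.C c * q)
      = c • Ideal.Quotient.mk I q := fun c q => by
    rw [← MvPolynomial.smul_eq_C_mul]
    rfl
  let q : Fin (m + 1) → MvPolynomial (Fin (m + 1)) K ⧸ I :=
    fun i => Ideal.Quotient.mk I (MvPolynomial.X i)
  have hfin : ((Set.range fun i : Fin m => q i.castSucc) ∪
      {1, q (Fin.last m), q i₀.castSucc * q i₀.castSucc}).Finite :=
    (Set.finite_range _).union (by simp)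
  have := FiniteDimensional.span_of_finite K hfin
  obtain ⟨φ, hφ⟩ := exists_quotient_algEquiv (f := f) (I := I)
    (S := Submodule.span K ((Set.range fun i : Fin m => q i.castSucc) ∪
      {1, q (Fin.last m), q i₀.castSucc * q i₀.castSucc})) (fun p hp => hI hp) hsurj
    (Submodule.subset_span (by simp))
    (fun s p hp => mul_mem_span (v := fun i : Fin m => q i.castSucc)
      (fun i => by
        simp only [q]
        rw [← map_mul]
        exact Ideal.Quotient.eq_zero_iff_mem.mpr (hz i))
      (by
        simp only [q]
        rw [← map_mul]
        exact Ideal.Quotient.eq_zero_iff_mem.mpr hzz)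
      (fun i j => by
        obtain ⟨c, d, hcd⟩ := hv i j
        refine ⟨c, d, ?_⟩
        have := Ideal.Quotient.eq.mpr hcd
        rwa [map_add, hmk, hmk, map_mul, map_mul] at this)
      (by
        simp only [q]
        rw [← map_mul, ← map_mul]
        exact Ideal.Quotient.eq_zero_iff_mem.mpr hcube)
      (by
        induction s using Fin.lastCases with
        | last => exact Or.inl rfl
        | cast s => exact Or.inr ⟨s, rfl⟩) hp)
    ((finrank_span_le _ _ _ _).trans (by rw [Module.finrank_eq_card_basis e, Fintype.card_fin]))
  exact ⟨φ, fun i => (hφ _).trans (hfX i)⟩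

theorem exists_algEquiv_polynomial_quotient [FiniteDimensional K R] {d : ℕ} {a : R} (ha : a ^ d = 0)
    (hd : Module.finrank K R = d)
    (hspan : Submodule.span K (Set.range fun k : ℕ => a ^ k) = ⊤) :
    ∃ φ : (Polynomial K ⧸ (Ideal.span {Polynomial.X ^ d} : Ideal (Polynomial K))) ≃ₐ[K] R,
      ∀ p, φ (Ideal.Quotient.mk _ p) = Polynomial.aeval a p := by
  let φ : (Polynomial K ⧸ (Ideal.span {Polynomial.X ^ d} : Ideal (Polynomial K))) →ₐ[K] R :=
    Ideal.Quotient.liftₐ _ (Polynomial.aeval a) fun p hp => by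
      obtain ⟨q, rfl⟩ := Ideal.mem_span_singleton.mp hp
      simp [ha]
  have hφ : ∀ p, φ (Ideal.Quotient.mk _ p) = Polynomial.aeval a p := fun p => rfl
  have hsurj : Function.Surjective φ := by
    have h1 : Submodule.span K (Set.range fun k : ℕ => a ^ k)
        ≤ Subalgebra.toSubmodule φ.range := Submodule.span_le.mpr (by
      rintro _ ⟨k, rfl⟩
      exact ⟨Ideal.Quotient.mk _ (Polynomial.X ^ k), by
        change φ (Ideal.Quotient.mk _ (Polynomial.X ^ k)) = _
        rw [hφ]
        simp⟩)
    intro r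
    rw [hspan] at h1
    exact h1 (Submodule.mem_top (x := r))
  have hfin : FiniteDimensional K
      (Polynomial K ⧸ (Ideal.span {Polynomial.X ^ d} : Ideal (Polynomial K))) :=
    (Polynomial.monic_X_pow d).finite_quotient
  have hinj : Function.Injective φ :=
    (LinearMap.injective_iff_surjective_of_finrank_eq_finrank (f := φ.toLinearMap)
      (by rw [finrank_quotient_span_eq_natDegree, Polynomial.natDegree_X_pow, hd])).mpr hsurj
  exact ⟨AlgEquiv.ofBijective φ ⟨hinj, hsurj⟩, hφ⟩

end Presentation

/-! ### The structure constants of `R` and its presentation. -/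

namespace IsCorankOnePair

variable {K R : Type*} [Field K] [IsAlgClosed K] [CharZero K] [CommRing R] [IsLocalRing R]
  [Algebra K R] {n : ℕ} {F : LinearMap.BilinForm K R} {W : Submodule K R}

/-- Products of elements of `W` are combinations of a fixed vector and a generator of the kernel. -/
theorem exists_mul_eq (h : IsCorankOnePair n F W) {z : R} (hz : z ∈ LinearMap.ker F)
    (hz0 : z ≠ 0) :
    ∃ (u : R) (g : Module.Dual K R), ∀ x ∈ W, ∀ y ∈ W,
      x * y = F 1 (x * y) • u + g (x * y) • z := by
  have := h.finiteDimensional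
  obtain ⟨a, ha, ha1⟩ := h.exists_apply_one_sq
  obtain ⟨g₀, hg₀⟩ : ∃ g₀ : Module.Dual K R, g₀ z ≠ 0 := by
    by_contra! hcon
    exact hz0 ((Module.forall_dual_apply_eq_zero_iff K z).mp hcon)
  -- This functional removes the `a * a` part measured by `F 1` and normalizes `g₀` on `z`, so on a
  -- product from `W` it returns the coefficient of `z`.
  refine ⟨a * a, (g₀ z)⁻¹ • (g₀ - g₀ (a * a) • F 1), fun x hx y hy => ?_⟩
  obtain ⟨t, ht⟩ := (finrank_eq_one_iff_of_nonzero' (⟨z, hz⟩ : LinearMap.ker F)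
    (fun h0 => hz0 (congrArg Subtype.val h0))).mp h.finrank_ker ⟨_, h.mul_sub_mem_ker ha ha1 hx hy⟩
  have ht' : t • z = x * y - F 1 (x * y) • (a * a) := congrArg Subtype.val ht
  have h1 := congrArg g₀ ht'
  simp only [map_smul, map_sub, smul_eq_mul] at h1
  have h2 : ((g₀ z)⁻¹ • (g₀ - g₀ (a * a) • F 1)) (x * y) = t := by
    simp only [LinearMap.smul_apply, LinearMap.sub_apply, smul_eq_mul]
    rw [inv_mul_eq_iff_eq_mul₀ hg₀]
    linear_combination -h1
  rw [h2, ht', add_sub_cancel]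

/-- The presentation of `R` when `W` has dimension at least three. -/
theorem exists_algEquiv_relIdeal {m : ℕ} (h : IsCorankOnePair (m + 1) F W)
    {w : Fin m → R} (hw : ∀ i, w i ∈ W) {z u : R} (hz : z ∈ LinearMap.ker F)
    {L : Matrix (Fin m) (Fin m) K}
    (hmul : ∀ i j, w i * w j = (if i = j then (1 : K) else 0) • u + L i j • z)
    (hL : ∀ i j, L i j = L j i) {i₀ i₁ : Fin m} (h0 : ∀ i, i ≠ i₀ → i₀ < i) (h01 : i₁ ≠ i₀)
    (e : Module.Basis (Fin (m + 1 + 2)) K R) (he0 : e 0 = 1)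
    (hew : ∀ i : Fin m, e i.castSucc.castSucc.succ = w i)
    (hez : e (Fin.last m).castSucc.succ = z)
    (helast : e (Fin.last (m + 1 + 1)) = w i₀ * w i₀) :
    ∃ φ : (MvPolynomial (Fin (m + 1)) K ⧸ relIdeal (n := m + 1) (by omega) L) ≃ₐ[K] R,
      ∀ i, φ (Ideal.Quotient.mk _ (MvPolynomial.X i)) = e i.castSucc.succ := by
  have hzm : z ∈ IsLocalRing.maximalIdeal R := h.le_maximalIdeal (h.ker_le hz)
  set I := relIdeal (K := K) (n := m + 1) (by omega) L with hIdef
  let v : Fin m → MvPolynomial (Fin (m + 1)) K := fun i => MvPolynomial.X i.castSucc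
  let y : MvPolynomial (Fin (m + 1)) K := MvPolynomial.X (Fin.last m)
  have r1 : ∀ i j : Fin m, i < j → v i * v j - MvPolynomial.C (L i j) * y ∈ I := fun i j hij =>
    Ideal.subset_span (Or.inl (Or.inl ⟨i, j, hij, rfl⟩))
  have r2 : ∀ i j : Fin m, i < j →
      v i ^ 2 - v j ^ 2 - MvPolynomial.C (L i i - L j j) * y ∈ I := fun i j hij =>
    Ideal.subset_span (Or.inl (Or.inr ⟨i, j, hij, rfl⟩))
  have r3 : ∀ s : Fin (m + 1), MvPolynomial.X s * y ∈ I := fun s =>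
    Ideal.subset_span (Or.inr ⟨s, rfl⟩)
  have r1' : ∀ i j : Fin m, i ≠ j → v i * v j - MvPolynomial.C (L i j) * y ∈ I := fun i j hij => by
    rcases lt_or_gt_of_ne hij with hlt | hlt
    · exact r1 i j hlt
    · rw [hL, mul_comm (v i)]
      exact r1 j i hlt
  refine exists_algEquiv_of_relations e he0 (i₀ := i₀) (by rw [helast, hew]) ?_
    (fun i => r3 _) (r3 _) (fun i j => ?_) ?_
  · refine Ideal.span_le.mpr ?_
    rintro p ((⟨i, j, hij, rfl⟩ | ⟨i, j, hij, rfl⟩) | ⟨s, rfl⟩)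
    · change MvPolynomial.aeval (R := K) (fun i : Fin (m + 1) => e i.castSucc.succ)
        (v i * v j - MvPolynomial.C (L i j) * y) = 0
      simp only [v, y, map_sub, map_mul, MvPolynomial.aeval_X, MvPolynomial.aeval_C, hew, hez,
        hmul, Algebra.smul_def]
      rw [if_neg (ne_of_lt hij)]
      simp
    · change MvPolynomial.aeval (R := K) (fun i : Fin (m + 1) => e i.castSucc.succ)
        (v i ^ 2 - v j ^ 2 - MvPolynomial.C (L i i - L j j) * y) = 0
      simp only [v, y, map_sub, map_mul, MvPolynomial.aeval_X, MvPolynomial.aeval_C, hew, hez,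
        pow_two, hmul, Algebra.smul_def]
      simp
      ring
    · change MvPolynomial.aeval (R := K) (fun i : Fin (m + 1) => e i.castSucc.succ)
        (MvPolynomial.X s * y) = 0
      simp only [y, map_mul, MvPolynomial.aeval_X, hez]
      refine h.mul_eq_zero_of_mem_ker hz ?_
      induction s using Fin.lastCases with
      | last => rwa [hez]
      | cast s => rw [hew]; exact h.le_maximalIdeal (hw s)
  · by_cases hij : i = j
    · subst hij
      by_cases hi : i = i₀
      · subst hi
        exact ⟨1, 0, by simp⟩
      · refine ⟨1, L i i - L i₀ i₀, ?_⟩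
        convert neg_mem (r2 i₀ i (h0 i hi)) using 1
        simp only [v, y, map_sub, map_one]
        ring
    · exact ⟨0, L i j, by simpa using r1' i j hij⟩
  · have h2 := r2 i₀ i₁ (h0 i₁ h01)
    have h1 := r1' i₀ i₁ h01.symm
    -- Modulo the relations, `v i₀ ^ 3` becomes `v i₀ * v i₁ ^ 2`, and then `v i₀ * v i₁` is a
    -- multiple of `y`, which `v i₁` kills. A second index is needed, hence `n ≥ 3`.
    have : v i₀ * v i₀ * v i₀
        = v i₀ * (v i₀ ^ 2 - v i₁ ^ 2 - MvPolynomial.C (L i₀ i₀ - L i₁ i₁) * y)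
          + v i₁ * (v i₀ * v i₁ - MvPolynomial.C (L i₀ i₁) * y)
          + MvPolynomial.C (L i₀ i₀ - L i₁ i₁) * (v i₀ * y)
          + MvPolynomial.C (L i₀ i₁) * (v i₁ * y) := by ring
    change v i₀ * v i₀ * v i₀ ∈ I
    rw [this]
    exact add_mem (add_mem (add_mem (I.mul_mem_left _ h2) (I.mul_mem_left _ h1))
      (I.mul_mem_left _ (r3 _))) (I.mul_mem_left _ (r3 _))

end IsCorankOnePair
end CorankOne

/-! ### The classification, by the size of `n` and the vanishing of a cube. -/

theorem proposition5 {K : Type*} [Field K] [IsAlgClosed K] [CharZero K]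
    (im : K) (him : im ^ 2 = -1)
    {R : Type*} [CommRing R] [IsLocalRing R] [Algebra K R]
    (n : ℕ) (hn : 2 ≤ n) (hR : Module.finrank K R = n + 2)
    (F : LinearMap.BilinForm K R) (hsymm : F.IsSymm)
    (hrank : Module.finrank K (LinearMap.range F) = n + 1) (hF1 : F 1 1 = 0)
    (W : Submodule K R)
    (hWm : W ≤ (IsLocalRing.maximalIdeal R).restrictScalars K)
    (hW : Module.finrank K W + 1 = Module.finrank K (IsLocalRing.maximalIdeal R))
    (hinv : CorankOne.IsInvariant W F) :
    ∃ e : Module.Basis (Fin (n + 2)) K R,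
      e 0 = 1 ∧
      W = Submodule.span K (Set.range fun i : Fin n => e i.castSucc.succ) ∧
      (IsLocalRing.maximalIdeal R).restrictScalars K
        = Submodule.span K (Set.range fun i : Fin (n + 1) => e i.succ) ∧
      e (Fin.last (n + 1)) = e 1 ^ 2 ∧
      LinearMap.BilinForm.toMatrix e F = CorankOne.normalMatrix K n ∧
      ((3 ≤ n ∧ ∃ L : Matrix (Fin (n - 1)) (Fin (n - 1)) K, CorankOne.IsCanonical im L ∧
          ∃ φ : (MvPolynomial (Fin n) K ⧸ CorankOne.relIdeal (by omega) L) ≃ₐ[K] R,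
            ∀ i : Fin n, φ (Ideal.Quotient.mk _ (MvPolynomial.X i)) = e i.castSucc.succ) ∨
        (n = 2 ∧ ∃ φ : (MvPolynomial (Fin 2) K ⧸
              (Ideal.span {MvPolynomial.X 0 ^ 3, MvPolynomial.X 0 * MvPolynomial.X 1,
                MvPolynomial.X 1 ^ 2} : Ideal (MvPolynomial (Fin 2) K))) ≃ₐ[K] R,
            φ (Ideal.Quotient.mk _ (MvPolynomial.X 0)) = e ⟨1, by omega⟩ ∧
            φ (Ideal.Quotient.mk _ (MvPolynomial.X 1)) = e ⟨2, by omega⟩) ∨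
        (n = 2 ∧ ∃ φ : (Polynomial K ⧸
              (Ideal.span {Polynomial.X ^ 4} : Ideal (Polynomial K))) ≃ₐ[K] R,
            φ (Ideal.Quotient.mk _ Polynomial.X) = e ⟨1, by omega⟩ ∧
            φ (Ideal.Quotient.mk _ (Polynomial.X ^ 3)) = e ⟨2, by omega⟩ ∧
            φ (Ideal.Quotient.mk _ (Polynomial.X ^ 2)) = e ⟨3, by omega⟩)) := by
  have h : CorankOne.IsCorankOnePair n F W :=
    ⟨hn, hR, hsymm.eq, hrank, hF1, hWm, hW, hinv⟩
  have hfin := h.finiteDimensional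
  obtain ⟨m, rfl⟩ : ∃ m, n = m + 1 := ⟨n - 1, by omega⟩
  obtain ⟨z, hz, hz0⟩ := Submodule.exists_mem_ne_zero_of_ne_bot (p := LinearMap.ker F) (by
    intro h0
    have := h.finrank_ker
    rw [h0, finrank_bot] at this
    omega)
  have one_eq : ∀ hm : 0 < m, (1 : Fin (m + 1 + 2)) = (⟨0, hm⟩ : Fin m).castSucc.castSucc.succ :=
    fun hm => Fin.ext (by simp)
  by_cases hm : 2 ≤ m
  · obtain ⟨u, g, hug⟩ := h.exists_mul_eq hz hz0
    obtain ⟨w, hw, hww, hcan⟩ : ∃ w : Fin m → R, (∀ i, w i ∈ W) ∧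
      (∀ i j, F 1 (w i * w j) = if i = j then 1 else 0) ∧
      CorankOne.IsCanonical im (Matrix.of fun i j => g (w i * w j)) :=
        h.exists_orthonormal_family him g
    obtain ⟨e, he0, hew, hez, helast, heW, hem, heF⟩ :=
      h.exists_basis hw hww hz hz0 ⟨0, by omega⟩
    refine ⟨e, he0, heW, hem, ?_, heF, Or.inl ⟨by omega, _, hcan, ?_⟩⟩
    · rw [helast, one_eq (by omega), hew, pow_two]
    · exact h.exists_algEquiv_relIdeal hw hz (u := u)
        (fun i j => by rw [← hww]; exact hug _ (hw i) _ (hw j))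
        (fun i j => congrArg g (mul_comm _ _)) (i₀ := ⟨0, by omega⟩) (i₁ := ⟨1, by omega⟩)
        (fun i hi => Fin.lt_def.mpr (Nat.pos_of_ne_zero fun h0 => hi (Fin.ext h0))) (by simp) e he0 hew hez helast
  obtain rfl : m = 1 := by omega
  obtain ⟨a, ha, ha1⟩ := h.exists_apply_one_sq
  have hww : ∀ i j : Fin 1, F 1 (a * a) = if i = j then 1 else 0 := fun i j => by
    rw [ha1, if_pos (Subsingleton.elim i j)]
  -- The cube always lies in the kernel line; when nonzero it can itself serve as the generator of
  -- that line, and `R` is generated by `a`.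
  by_cases hcube : a * a * a = 0
  · obtain ⟨e, he0, hew, hez, helast, heW, hem, heF⟩ :=
      h.exists_basis (w := fun _ : Fin 1 => a) (fun _ => ha) hww hz hz0 0
    refine ⟨e, he0, heW, hem, ?_, heF, Or.inr (Or.inl ⟨rfl, ?_⟩)⟩
    · rw [helast, one_eq one_pos, hew, pow_two]
    set I : Ideal (MvPolynomial (Fin 2) K) := Ideal.span {MvPolynomial.X 0 ^ 3,
      MvPolynomial.X 0 * MvPolynomial.X 1, MvPolynomial.X 1 ^ 2} with hI
    have r1 : (MvPolynomial.X 0 ^ 3 : MvPolynomial (Fin 2) K) ∈ I :=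
      Ideal.subset_span (by simp)
    have r2 : (MvPolynomial.X 0 * MvPolynomial.X 1 : MvPolynomial (Fin 2) K) ∈ I :=
      Ideal.subset_span (by simp)
    have r3 : (MvPolynomial.X 1 ^ 2 : MvPolynomial (Fin 2) K) ∈ I :=
      Ideal.subset_span (by simp)
    have e1 : e 1 = a := hew 0
    have e2 : e 2 = z := hez
    obtain ⟨φ, hφ⟩ := CorankOne.exists_algEquiv_of_relations e he0 (i₀ := 0) (I := I)
      (by rw [helast, hew]) (by
        refine Ideal.span_le.mpr ?_
        rintro p (rfl | rfl | rfl)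
        · simpa [e1, pow_succ] using hcube
        · simpa [e1, e2] using h.mul_eq_zero_of_mem_ker hz (h.le_maximalIdeal ha)
        · simpa [e2, pow_two] using
            h.mul_eq_zero_of_mem_ker hz (h.le_maximalIdeal (h.ker_le hz)))
      (fun i => by rw [Subsingleton.elim i 0]; exact r2) (by rw [← pow_two]; exact r3)
      (fun i j => ⟨1, 0, by rw [Subsingleton.elim i 0, Subsingleton.elim j 0]; simp⟩)
      (by convert r1 using 1; simp only [Fin.castSucc_zero]; ring)
    exact ⟨φ, hφ 0, hφ 1⟩
  · obtain ⟨e, he0, hew, hez, helast, heW, hem, heF⟩ :=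
      h.exists_basis (w := fun _ : Fin 1 => a) (fun _ => ha) hww (h.cube_mem_ker ha ha1) hcube 0
    refine ⟨e, he0, heW, hem, ?_, heF, Or.inr (Or.inr ⟨rfl, ?_⟩)⟩
    · rw [helast, one_eq one_pos, hew, pow_two]
    have e1 : e ⟨1, by omega⟩ = a := hew 0
    have e2 : e ⟨2, by omega⟩ = a * a * a := hez
    have e3 : e ⟨3, by omega⟩ = a * a := helast
    have h4 : a ^ 4 = 0 := by
      rw [← h.mul_eq_zero_of_mem_ker (h.cube_mem_ker ha ha1) (h.le_maximalIdeal ha)]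
      ring
    obtain ⟨φ, hφ⟩ := CorankOne.exists_algEquiv_polynomial_quotient h4 hR (by
      refine top_unique (e.span_eq ▸ Submodule.span_le.mpr ?_)
      rintro _ ⟨k, rfl⟩
      refine Submodule.subset_span ?_
      -- The powers appear in the order `0, 1, 3, 2`, since the kernel vector `a ^ 3` precedes `a ^
      -- 2` in the basis.
      fin_cases k
      · exact ⟨0, by simpa using he0.symm⟩
      · exact ⟨1, by simpa using e1.symm⟩
      · exact ⟨3, (by ring : a ^ 3 = a * a * a).trans e2.symm⟩
      · exact ⟨2, (pow_two a).trans e3.symm⟩)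
    refine ⟨φ, ?_, ?_, ?_⟩
    · rw [hφ, e1, Polynomial.aeval_X]
    · rw [hφ, e2, map_pow, Polynomial.aeval_X]; ring
    · rw [hφ, e3, map_pow, Polynomial.aeval_X]; ring
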